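/- Let $G$ be a (real, finite-dimensional) Lie group with Lie algebra $\mathfrak{g}$, and let $\kappa(x,y)=\mathrm{tr}(\mathrm{ad}(x)\,\mathrm{ad}(y))$ be the Killing form of $\mathfrak{g}$ (called the Killing form of $G$), which we also regard as a left-invariant tensor field on $G$. We call $G$ semisimple (respectively solvable) if $\mathfrak{g}$ is semisimple (respectively solvable). Let $\mathsf{g}$ be a bi-invariant pseudo-Riemannian metric on $G$, that is, a smooth field of nondegenerate symmetric bilinear forms of arbitrary signature on the tangent spaces of $G$ such that all left and all right translations are isometries. Suppose that $\mathsf{g}$ is Einstein, that is, the Ricci tensor of its Levi-Civita connection satisfies $\mathrm{Ric}=\lambda\,\mathsf{g}$ for some real constant $\lambda$. Then (a) either $G$ is semisimple and $\mathsf{g}=c\,\kappa$ on $G$ for some real constant $c\neq 0$, (b) or $G$ is solvable and its Killing form $\kappa$ vanishes. -/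

import Mathlib

open Bundle
open scoped Manifold ContDiff

/-- The smoothness `minSmoothness ℝ 3` (which is just `3`) that Mathlib asks for in the
construction of the Lie algebra of a Lie group is at most `∞`. -/
instance instLEInftyMinSmoothnessRealThree : ENat.LEInfty (minSmoothness ℝ 3) :=
  ⟨by
    rw [minSmoothness_of_isRCLikeNormedField]
    exact ENat.LEInfty.out⟩

section Manifold

variable {E : Type*} [NormedAddCommGroup E] [NormedSpace ℝ E]
  {H : Type*} [TopologicalSpace H] (I : ModelWithCorners ℝ E H)
  (M : Type*) [TopologicalSpace M] [ChartedSpace H M]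

/-- A smooth pseudo-Riemannian metric on a manifold `M`: a smooth field of nondegenerate symmetric
bilinear forms on the tangent spaces. There is no condition on the signature. -/
structure PseudoRiemannianMetric [IsManifold I ∞ M] where
  /-- The bilinear form on the tangent space at `x`. -/
  val (x : M) : TangentSpace I x →L[ℝ] TangentSpace I x →L[ℝ] ℝ
  symm (x : M) (v w : TangentSpace I x) : val x v w = val x w v
  nondegenerate (x : M) (v : TangentSpace I x) (hv : ∀ w : TangentSpace I x, val x v w = 0) : v = 0
  contMDiff : ContMDiff I (I.prod 𝓘(ℝ, E →L[ℝ] E →L[ℝ] ℝ)) ∞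
    (fun x ↦ TotalSpace.mk' (E →L[ℝ] E →L[ℝ] ℝ)
      (E := fun x : M ↦ TangentSpace I x →L[ℝ] TangentSpace I x →L[ℝ] ℝ) x (val x))

variable {I M}

namespace CovariantDerivative

/-- The curvature operator on vector fields,
`R(X, Y) Z = ∇_X ∇_Y Z - ∇_Y ∇_X Z - ∇_[X, Y] Z`, where `∇_X Z` at `x` is `cov Z x (X x)`. -/
noncomputable def curvatureField [IsManifold I 1 M]
    (cov : CovariantDerivative I E (TangentSpace I : M → Type _))
    (X Y Z : Π x : M, TangentSpace I x) (x : M) : TangentSpace I x :=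
  cov (fun y ↦ cov Z y (Y y)) x (X x) - cov (fun y ↦ cov Z y (X y)) x (Y x)
    - cov Z x (VectorField.mlieBracket I X Y x)

/-- The Ricci curvature `Ric(Y, Z)` at `x`: the trace of the endomorphism `u ↦ R(u, Y) Z` of the
tangent space at `x`, computed as the sum of the diagonal coefficients in a basis `b` of the tangent
space, where each basis vector is extended to a vector field that is smooth near `x`. -/
noncomputable def ricci [FiniteDimensional ℝ E] [IsManifold I 1 M]
    (cov : CovariantDerivative I E (TangentSpace I : M → Type _))
    (Y Z : Π x : M, TangentSpace I x) (x : M) : ℝ :=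
  let b : Module.Basis (Fin (Module.finrank ℝ E)) ℝ (TangentSpace I x) := Module.finBasis ℝ E
  ∑ i, b.repr (cov.curvatureField (FiberBundle.extend E (b i)) Y Z x) i

end CovariantDerivative

namespace PseudoRiemannianMetric

variable [IsManifold I ∞ M]

/-- `cov` is the Levi-Civita connection of `g`: it is torsion-free, and it is metric, that is,
`v (g(Y, Z)) = g(∇_v Y, Z) + g(Y, ∇_v Z)`. -/
structure IsLeviCivita [FiniteDimensional ℝ E] [CompleteSpace E] (g : PseudoRiemannianMetric I M)
    (cov : CovariantDerivative I E (TangentSpace I : M → Type _)) : Prop where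
  torsion_eq_zero : cov.torsion = 0
  metric (x : M) (Y Z : Π x : M, TangentSpace I x) (v : TangentSpace I x)
    (hY : MDiffAt (T% Y) x) (hZ : MDiffAt (T% Z) x) :
    d% (fun y ↦ g.val y (Y y) (Z y)) x v =
      g.val x (cov Y x v) (Z x) + g.val x (Y x) (cov Z x v)

/-- `g` is an Einstein metric: there is a real constant `c` such that the Ricci tensor of the
Levi-Civita connection of `g` satisfies `Ric = c g`. -/
def IsEinstein [FiniteDimensional ℝ E] [CompleteSpace E] (g : PseudoRiemannianMetric I M) : Prop :=
  ∃ cov : CovariantDerivative I E (TangentSpace I : M → Type _), g.IsLeviCivita cov ∧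
    ∃ c : ℝ, ∀ Y Z : Π x : M, TangentSpace I x, CMDiff ∞ (T% Y) → CMDiff ∞ (T% Z) →
      ∀ x : M, cov.ricci Y Z x = c * g.val x (Y x) (Z x)

end PseudoRiemannianMetric

end Manifold

section LieGroup

variable {E : Type*} [NormedAddCommGroup E] [NormedSpace ℝ E]
  {H : Type*} [TopologicalSpace H] {I : ModelWithCorners ℝ E H}
  {G : Type*} [TopologicalSpace G] [ChartedSpace H G] [Group G] [IsManifold I ∞ G]

/-- A pseudo-Riemannian metric on a Lie group is bi-invariant if all left translations and all right
translations are isometries. -/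
structure PseudoRiemannianMetric.IsBiInvariant (g : PseudoRiemannianMetric I G) : Prop where
  left (a x : G) (v w : TangentSpace I x) :
    g.val (a * x) (mfderiv I I (fun y ↦ a * y) x v) (mfderiv I I (fun y ↦ a * y) x w) = g.val x v w
  right (a x : G) (v w : TangentSpace I x) :
    g.val (x * a) (mfderiv I I (fun y ↦ y * a) x v) (mfderiv I I (fun y ↦ y * a) x w) = g.val x v w

end LieGroup

section LieGroup

variable {E : Type*} [NormedAddCommGroup E] [NormedSpace ℝ E] [CompleteSpace E]
  {H : Type*} [TopologicalSpace H] (I : ModelWithCorners ℝ E H)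
  (G : Type*) [TopologicalSpace G] [ChartedSpace H G] [Group G] [LieGroup I ∞ G]

/-- A Lie group is semisimple if its Lie algebra is semisimple. -/
def IsSemisimpleLieGroup : Prop := LieAlgebra.IsSemisimple ℝ (GroupLieAlgebra I G)

/-- A Lie group is solvable if its Lie algebra is solvable. -/
def IsSolvableLieGroup : Prop := LieAlgebra.IsSolvable (GroupLieAlgebra I G)

end LieGroup

section InvariantFields

open Filter Function Set VectorField
open scoped Topology

variable {E : Type*} [NormedAddCommGroup E] [NormedSpace ℝ E]
  {H : Type*} [TopologicalSpace H] {I : ModelWithCorners ℝ E H}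
  {G : Type*} [TopologicalSpace G] [ChartedSpace H G] [Group G]

/-- The right-invariant vector field on a Lie group with value `v` at the identity. -/
noncomputable def rightInvariantVectorField (v : GroupLieAlgebra I G) (x : G) :
    TangentSpace I x :=
  mfderiv I I (fun y ↦ y * x) 1 v

lemma mulInvariantVectorField_one (v : GroupLieAlgebra I G) :
    mulInvariantVectorField v (1 : G) = v := by
  have h : HasMFDerivAt I I (fun y : G ↦ 1 * y) 1 (ContinuousLinearMap.id ℝ (TangentSpace I 1)) :=
    (hasMFDerivAt_id 1).congr_of_eventuallyEq (Eventually.of_forall fun y ↦ one_mul y)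
  exact congr($(h.mfderiv) v)

lemma rightInvariantVectorField_one (v : GroupLieAlgebra I G) :
    rightInvariantVectorField v (1 : G) = v := by
  have h : HasMFDerivAt I I (fun y : G ↦ y * 1) 1 (ContinuousLinearMap.id ℝ (TangentSpace I 1)) :=
    (hasMFDerivAt_id 1).congr_of_eventuallyEq (Eventually.of_forall fun y ↦ mul_one y)
  exact congr($(h.mfderiv) v)

variable [LieGroup I ∞ G]

theorem contMDiff_infty_mulInvariantVectorField (v : GroupLieAlgebra I G) :
    CMDiff ∞ (fun x : G ↦ (mulInvariantVectorField v x : TangentBundle I G)) := by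
  have S₁ : CMDiff ∞ (fun x : G ↦ ((TotalSpace.mk' E x 0 : TangentBundle I G),
      (TotalSpace.mk' E 1 v : TangentBundle I G))) :=
    (contMDiff_zeroSection _ _).prodMk contMDiff_const
  have S₂ : CMDiff ∞ (equivTangentBundleProd I G I G).symm :=
    contMDiff_equivTangentBundleProd_symm
  have S₃ : CMDiff ∞ (tangentMap (I.prod I) I (fun p : G × G ↦ p.1 * p.2)) :=
    (contMDiff_mul I ∞).contMDiff_tangentMap le_rfl
  convert! (S₃.comp S₂).comp S₁ with x
  · simp
  · simp only [comp_apply, tangentMap]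
    rw [mfderiv_prod_eq_add_apply ((contMDiff_mul I ∞).mdifferentiableAt (by simp))]
    change mfderiv I I (fun z ↦ x * z) 1 v =
      mfderiv I I (fun z ↦ z * 1) x 0 + mfderiv I I (fun z ↦ x * z) 1 v
    rw [map_zero]
    exact (zero_add _).symm

theorem contMDiff_infty_rightInvariantVectorField (v : GroupLieAlgebra I G) :
    CMDiff ∞ (fun x : G ↦ (rightInvariantVectorField v x : TangentBundle I G)) := by
  have S₁ : CMDiff ∞ (fun x : G ↦ ((TotalSpace.mk' E 1 v : TangentBundle I G),
      (TotalSpace.mk' E x 0 : TangentBundle I G))) :=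
    contMDiff_const.prodMk (contMDiff_zeroSection _ _)
  have S₂ : CMDiff ∞ (equivTangentBundleProd I G I G).symm :=
    contMDiff_equivTangentBundleProd_symm
  have S₃ : CMDiff ∞ (tangentMap (I.prod I) I (fun p : G × G ↦ p.1 * p.2)) :=
    (contMDiff_mul I ∞).contMDiff_tangentMap le_rfl
  convert! (S₃.comp S₂).comp S₁ with x
  · simp
  · simp only [comp_apply, tangentMap]
    rw [mfderiv_prod_eq_add_apply ((contMDiff_mul I ∞).mdifferentiableAt (by simp))]
    change mfderiv I I (fun z ↦ z * x) 1 v =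
      mfderiv I I (fun z ↦ z * x) 1 v + mfderiv I I (fun z ↦ 1 * z) x 0
    rw [map_zero]
    exact (add_zero _).symm

theorem mdifferentiableAt_rightInvariantVectorField (v : GroupLieAlgebra I G) (x : G) :
    MDiffAt (fun x : G ↦ (rightInvariantVectorField v x : TangentBundle I G)) x :=
  (contMDiff_infty_rightInvariantVectorField v).mdifferentiableAt (by simp)

lemma mfderivWithin_extChartAt_symm_inverse_mfderiv {a : G} {x : E}
    (hx : x ∈ (extChartAt I a).target) {c : G → G} {b : G} (hc : MDiffAt c b)
    (hcb : c b = (extChartAt I a).symm x) {d : E → G} {p : E} (hd : MDiffAt d p) (hdp : d p = b)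
    (ξ : E) :
    (mfderivWithin 𝓘(ℝ, E) I (extChartAt I a).symm (range I) x).inverse
      (mfderiv I I c b (mfderiv 𝓘(ℝ, E) I d p ξ)) =
      fderiv ℝ (fun y ↦ extChartAt I a (c (d y))) p ξ := by
  subst hdp
  have hinv : (mfderivWithin 𝓘(ℝ, E) I (extChartAt I a).symm (range I) x).inverse =
      mfderiv I 𝓘(ℝ, E) (extChartAt I a) ((extChartAt I a).symm x) :=
    ContinuousLinearMap.inverse_eq (mfderivWithin_extChartAt_symm_comp_mfderiv_extChartAt hx)
      (mfderiv_extChartAt_comp_mfderivWithin_extChartAt_symm hx)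
  have hsrc : c (d p) ∈ (chartAt H a).source := by
    rw [hcb, ← extChartAt_source I]
    exact (extChartAt I a).map_target hx
  have hcd : HasMFDerivAt 𝓘(ℝ, E) I (c ∘ d) p
      ((mfderiv I I c (d p)).comp (mfderiv 𝓘(ℝ, E) I d p)) :=
    hc.hasMFDerivAt.comp p hd.hasMFDerivAt
  have h := (mdifferentiableAt_extChartAt (I := I) hsrc).hasMFDerivAt.comp p hcd
  rw [hinv, ← hcb]
  rw [← mfderiv_eq_fderiv]
  exact congr($(h.mfderiv) ξ).symm

/-- Left-invariant and right-invariant vector fields commute, at the identity. -/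
theorem mlieBracket_mulInvariantVectorField_rightInvariantVectorField [I.Boundaryless]
    (u v : GroupLieAlgebra I G) :
    mlieBracket I (mulInvariantVectorField u) (rightInvariantVectorField v) (1 : G) = 0 := by
  set φ := extChartAt I (1 : G)
  set p := φ 1
  let μ : E × E → E := fun q ↦ φ (φ.symm q.1 * φ.symm q.2)
  have hψp : φ.symm p = 1 := extChartAt_to_inv (I := I) (1 : G)
  have htgt : φ.target ∈ 𝓝 p := extChartAt_target_mem_nhds (I := I) (1 : G)
  have hψ : ContMDiffAt 𝓘(ℝ, E) I ∞ φ.symm p :=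
    (contMDiffOn_extChartAt_symm (1 : G)).contMDiffAt htgt
  have hψd : MDiffAt φ.symm p := hψ.mdifferentiableAt (by simp)
  have hμ : ContDiffAt ℝ ∞ μ (p, p) := by
    rw [← contMDiffAt_iff_contDiffAt]
    have h1 : ContMDiffAt 𝓘(ℝ, E × E) I ∞ (fun q : E × E ↦ φ.symm q.1) (p, p) :=
      ContMDiffAt.comp (p, p) hψ contDiff_fst.contMDiff.contMDiffAt
    have h2 : ContMDiffAt 𝓘(ℝ, E × E) I ∞ (fun q : E × E ↦ φ.symm q.2) (p, p) :=
      ContMDiffAt.comp (p, p) hψ contDiff_snd.contMDiff.contMDiffAt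
    have h3 : ContMDiffAt I 𝓘(ℝ, E) ∞ φ (φ.symm p * φ.symm p) := by
      rw [hψp, mul_one]
      exact contMDiffAt_extChartAt
    exact ContMDiffAt.comp (p, p) h3 (h1.mul h2)
  have hsurj : ∀ w : GroupLieAlgebra I G, ∃ ξ : E, mfderiv 𝓘(ℝ, E) I φ.symm p ξ = w := by
    intro w
    have := mfderivWithin_extChartAt_symm_comp_mfderiv_extChartAt (I := I) (x := (1 : G))
      (mem_extChartAt_target (1 : G))
    rw [I.range_eq_univ, mfderivWithin_univ] at this
    exact ⟨_, congr($this w)⟩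
  obtain ⟨ξ, rfl⟩ := hsurj u
  obtain ⟨η, rfl⟩ := hsurj v
  have hμd : ∀ᶠ q in 𝓝 (p, p), DifferentiableAt ℝ μ q :=
    ((hμ.of_le (m := 1) (by simp)).eventually (by simp)).mono
      fun q hq ↦ hq.differentiableAt (by simp)
  have hc₁ : Tendsto (fun x ↦ (x, p)) (𝓝 p) (𝓝 (p, p)) := (by fun_prop : Continuous _).tendsto p
  have hc₂ : Tendsto (fun x ↦ (p, x)) (𝓝 p) (𝓝 (p, p)) := (by fun_prop : Continuous _).tendsto p
  have hL : mpullbackWithin 𝓘(ℝ, E) I φ.symm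
      (mulInvariantVectorField (mfderiv 𝓘(ℝ, E) I φ.symm p ξ)) (range I)
      =ᶠ[𝓝 p] fun x ↦ fderiv ℝ μ (x, p) (0, ξ) := by
    filter_upwards [htgt, hc₁.eventually hμd] with x hx hd
    have h := mfderivWithin_extChartAt_symm_inverse_mfderiv (I := I) hx
      (c := fun y ↦ φ.symm x * y) (b := 1)
      (contMDiff_mul_left.contMDiffAt.mdifferentiableAt (n := ∞) (by simp))
      (mul_one _) hψd hψp ξ
    refine h.trans ?_
    have := hd.hasFDerivAt.comp (f := fun y ↦ (x, y)) p (hasFDerivAt_prodMk_right x p)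
    exact congr($(this.fderiv) ξ)
  have hR : mpullbackWithin 𝓘(ℝ, E) I φ.symm
      (rightInvariantVectorField (mfderiv 𝓘(ℝ, E) I φ.symm p η)) (range I)
      =ᶠ[𝓝 p] fun x ↦ fderiv ℝ μ (p, x) (η, 0) := by
    filter_upwards [htgt, hc₂.eventually hμd] with x hx hd
    have h := mfderivWithin_extChartAt_symm_inverse_mfderiv (I := I) hx
      (c := fun y ↦ y * φ.symm x) (b := 1)
      (contMDiff_mul_right.contMDiffAt.mdifferentiableAt (n := ∞) (by simp))
      (one_mul _) hψd hψp η
    refine h.trans ?_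
    have := hd.hasFDerivAt.comp (f := fun y ↦ (y, x)) p (hasFDerivAt_prodMk_left p x)
    exact congr($(this.fderiv) η)
  have hd2 : DifferentiableAt ℝ (fderiv ℝ μ) (p, p) :=
    (hμ.fderiv_right (m := ∞) le_rfl).differentiableAt (by simp)
  have hL' : fderiv ℝ (fun x ↦ fderiv ℝ μ (x, p) (0, ξ)) p η =
      fderiv ℝ (fderiv ℝ μ) (p, p) (η, 0) (0, ξ) := by
    have h1 := hd2.hasFDerivAt.comp (f := fun y ↦ (y, p)) p (hasFDerivAt_prodMk_left p p)
    have := h1.clm_apply (hasFDerivAt_const ((0 : E), ξ) p)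
    simpa using congr($(this.fderiv) η)
  have hR' : fderiv ℝ (fun x ↦ fderiv ℝ μ (p, x) (η, 0)) p ξ =
      fderiv ℝ (fderiv ℝ μ) (p, p) (0, ξ) (η, 0) := by
    have h1 := hd2.hasFDerivAt.comp (f := fun y ↦ (p, y)) p (hasFDerivAt_prodMk_right p p)
    have := h1.clm_apply (hasFDerivAt_const (η, (0 : E)) p)
    simpa using congr($(this.fderiv) ξ)
  have hL0 : fderiv ℝ μ (p, p) (0, ξ) = ξ := by
    have h0 := hμd.self_of_nhds.hasFDerivAt.comp (f := fun y ↦ (p, y)) p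
      (hasFDerivAt_prodMk_right p p)
    have h2 : HasFDerivAt (fun x ↦ μ (p, x)) (ContinuousLinearMap.id ℝ E) p := by
      refine (hasFDerivAt_id p).congr_of_eventuallyEq ?_
      filter_upwards [htgt] with x hx
      simp only [μ, hψp, one_mul, id]
      exact φ.right_inv hx
    exact congr($(h0.unique h2) ξ)
  have hR0 : fderiv ℝ μ (p, p) (η, 0) = η := by
    have h0 := hμd.self_of_nhds.hasFDerivAt.comp (f := fun y ↦ (y, p)) p
      (hasFDerivAt_prodMk_left p p)
    have h2 : HasFDerivAt (fun x ↦ μ (x, p)) (ContinuousLinearMap.id ℝ E) p := by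
      refine (hasFDerivAt_id p).congr_of_eventuallyEq ?_
      filter_upwards [htgt] with x hx
      simp only [μ, hψp, mul_one, id]
      exact φ.right_inv hx
    exact congr($(h0.unique h2) η)
  have key : ∀ V W : E → E, V =ᶠ[𝓝 p] (fun x ↦ fderiv ℝ μ (x, p) (0, ξ)) →
      W =ᶠ[𝓝 p] (fun x ↦ fderiv ℝ μ (p, x) (η, 0)) → ∀ s : Set E, s = univ →
      lieBracketWithin ℝ V W s p = 0 := by
    rintro V W hV hW s rfl
    rw [lieBracketWithin_univ, hV.lieBracket_vectorField_eq hW]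
    change fderiv ℝ (fun x ↦ fderiv ℝ μ (p, x) (η, 0)) p (fderiv ℝ μ (p, p) (0, ξ)) -
      fderiv ℝ (fun x ↦ fderiv ℝ μ (x, p) (0, ξ)) p (fderiv ℝ μ (p, p) (η, 0)) = 0
    rw [hL0, hR0, hL', hR', sub_eq_zero]
    exact (hμ.isSymmSndFDerivAt
      (minSmoothness_of_isRCLikeNormedField.trans_le ENat.LEInfty.out)).eq _ _
  rw [← mlieBracketWithin_univ, mlieBracketWithin_apply]
  exact (congrArg _ (key _ _ hL hR _ (by simp [I.range_eq_univ]))).trans (map_zero _)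

end InvariantFields

section BiInvariant

open VectorField

namespace CovariantDerivative

variable {E : Type*} [NormedAddCommGroup E] [NormedSpace ℝ E] [CompleteSpace E]
  {H : Type*} [TopologicalSpace H] {I : ModelWithCorners ℝ E H}
  {M : Type*} [TopologicalSpace M] [ChartedSpace H M] [IsManifold I 2 M]

/-- If `∇_X Z` is differentiable at `x` whenever `X` is, then the curvature `R(X, Y) Z` is tensorial
in `X`. -/
theorem tensorialAt_curvatureField
    (cov : CovariantDerivative I E (TangentSpace I : M → Type _))
    {Y Z : Π x : M, TangentSpace I x} {x : M}
    (hZ : ∀ X : Π x : M, TangentSpace I x, MDiffAt (T% X) x →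
      MDiffAt (T% (fun y ↦ cov Z y (X y))) x) :
    TensorialAt I E (fun X ↦ cov.curvatureField X Y Z x) x where
  smul {f X} hf hX := by
    have h : (fun y ↦ cov Z y ((f • X) y)) = f • fun y ↦ cov Z y (X y) := by
      ext1 y
      exact map_smul (cov Z y) (f y) (X y)
    simp only [curvatureField]
    rw [h, cov.isCovariantDerivativeOn.leibniz (hZ X hX) hf, mlieBracket_smul_left hf hX]
    simp
    module
  add {X X'} hX hX' := by
    have h : (fun y ↦ cov Z y ((X + X') y)) =
        (fun y ↦ cov Z y (X y)) + fun y ↦ cov Z y (X' y) := by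
      ext1 y
      exact map_add (cov Z y) (X y) (X' y)
    simp only [curvatureField]
    rw [h, cov.isCovariantDerivativeOn.add (hZ X hX) (hZ X' hX'), mlieBracket_add_left hX hX']
    simp
    module

end CovariantDerivative

variable {E : Type*} [NormedAddCommGroup E] [NormedSpace ℝ E]
  {H : Type*} [TopologicalSpace H] {I : ModelWithCorners ℝ E H}
  {G : Type*} [TopologicalSpace G] [ChartedSpace H G] [Group G] [LieGroup I ∞ G]

namespace PseudoRiemannianMetric

lemma mdifferentiableAt_val (g : PseudoRiemannianMetric I G) {X Y : Π x : G, TangentSpace I x}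
    {x : G} (hX : MDiffAt (T% X) x) (hY : MDiffAt (T% Y) x) :
    MDiffAt (fun y ↦ g.val y (X y) (Y y)) x := by
  have : MDifferentiableAt I (I.prod 𝓘(ℝ))
      (fun m ↦ TotalSpace.mk' ℝ (E := Bundle.Trivial G ℝ) m (g.val m (X m) (Y m))) x := by
    apply MDifferentiableAt.clm_bundle_apply₂ (F₁ := E) (F₂ := E)
    · exact g.contMDiff.mdifferentiableAt (by simp)
    · exact hX
    · exact hY
  simp only [mdifferentiableAt_totalSpace] at this
  exact this.2

namespace IsBiInvariant

variable {g : PseudoRiemannianMetric I G}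

lemma val_mulInvariantVectorField (hinv : g.IsBiInvariant) (x : G) (v w : GroupLieAlgebra I G) :
    g.val x (mulInvariantVectorField v x) (mulInvariantVectorField w x) = g.val 1 v w := by
  have h : ∀ y, y = x * 1 → ∀ a b : E, g.val y a b = g.val (x * 1) a b := by
    rintro _ rfl _ _
    rfl
  exact (h x (mul_one x).symm _ _).trans (hinv.left x 1 v w)

lemma val_rightInvariantVectorField (hinv : g.IsBiInvariant) (x : G) (v w : GroupLieAlgebra I G) :
    g.val x (rightInvariantVectorField v x) (rightInvariantVectorField w x) = g.val 1 v w := by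
  have h : ∀ y, y = 1 * x → ∀ a b : E, g.val y a b = g.val (1 * x) a b := by
    rintro _ rfl _ _
    rfl
  exact (h x (one_mul x).symm _ _).trans (hinv.right x 1 v w)

variable [FiniteDimensional ℝ E]

lemma exists_mulInvariantVectorField_eq (hinv : g.IsBiInvariant) (x : G) (t : TangentSpace I x) :
    ∃ v : GroupLieAlgebra I G, mulInvariantVectorField v x = t := by
  let f : E →ₗ[ℝ] E := (mfderiv I I (fun y : G ↦ x * y) 1).toLinearMap
  have hf : Function.Injective f := by
    rw [← LinearMap.ker_eq_bot, LinearMap.ker_eq_bot']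
    intro v hv
    refine g.nondegenerate 1 v fun w ↦ (hinv.val_mulInvariantVectorField x v w).symm.trans ?_
    have : mulInvariantVectorField (I := I) (G := G) v x = 0 := hv
    rw [this, map_zero]
    rfl
  exact (LinearMap.injective_iff_surjective.1 hf) t

instance finiteDimensional_groupLieAlgebra : FiniteDimensional ℝ (GroupLieAlgebra I G) :=
  inferInstanceAs (FiniteDimensional ℝ E)

/-- Every vector field which is differentiable at `x` is a combination of left-invariant vector
fields, with coefficients which are differentiable at `x`. -/
lemma exists_eq_sum_smul_mulInvariantVectorField (hinv : g.IsBiInvariant) {x : G}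
    {X : Π x : G, TangentSpace I x} (hX : MDiffAt (T% X) x) :
    ∃ (n : ℕ) (e : Fin n → GroupLieAlgebra I G) (f : Fin n → G → ℝ), (∀ i, MDiffAt (f i) x) ∧
      ∀ y, X y = ∑ i, f i y • mulInvariantVectorField (e i) y := by
  let b := Module.finBasis ℝ (GroupLieAlgebra I G)
  let B : LinearMap.BilinForm ℝ (GroupLieAlgebra I G) :=
    LinearMap.mk₂ ℝ (fun v w ↦ g.val 1 v w) (by simp) (by simp) (by simp) (by simp)
  have hB : B.Nondegenerate := by
    refine ⟨fun v hv ↦ g.nondegenerate 1 v hv, fun v hv ↦ g.nondegenerate 1 v fun w ↦ ?_⟩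
    rw [g.symm]
    exact hv w
  let e := B.dualBasis hB b
  refine ⟨_, e, fun i y ↦ g.val y (X y) (mulInvariantVectorField (b i) y), fun i ↦
    g.mdifferentiableAt_val hX (mdifferentiableAt_mulInvariantVectorField _), fun y ↦ ?_⟩
  obtain ⟨v, hv⟩ := hinv.exists_mulInvariantVectorField_eq y (X y)
  have hf (i) : g.val y (X y) (mulInvariantVectorField (b i) y) = g.val 1 v (b i) := by
    rw [← hv, hinv.val_mulInvariantVectorField]
  simp only [hf]
  rw [← hv]
  conv_lhs => rw [← e.sum_repr v]
  have hrepr (i) : e.repr v i = g.val 1 v (b i) := LinearMap.BilinForm.dualBasis_repr_apply hB b v i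
  simp only [hrepr]
  refine (map_sum (mfderiv I I (fun z : G ↦ y * z) 1) _ _).trans ?_
  exact Finset.sum_congr rfl fun i _ ↦ map_smul (mfderiv I I (fun z : G ↦ y * z) 1) _ _

variable [CompleteSpace E] {cov : CovariantDerivative I E (TangentSpace I : G → Type _)}

lemma covariantDerivative_skew (hLC : g.IsLeviCivita cov) {x : G} {Y Z : Π x : G, TangentSpace I x}
    {c : ℝ} (hc : ∀ y, g.val y (Y y) (Z y) = c)
    (hY : MDiffAt (T% Y) x) (hZ : MDiffAt (T% Z) x) (v : TangentSpace I x) :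
    g.val x (cov Y x v) (Z x) + g.val x (Y x) (cov Z x v) = 0 := by
  rw [← hLC.metric x Y Z v hY hZ]
  simp [hc, mvfderiv_const]

/-- The inner product on the Lie algebra defined by a bi-invariant metric is `ad`-invariant. -/
theorem val_lie_add [I.Boundaryless] (hinv : g.IsBiInvariant) (hLC : g.IsLeviCivita cov)
    (u v w : GroupLieAlgebra I G) :
    g.val 1 ⁅u, v⁆ w + g.val 1 v ⁅u, w⁆ = 0 := by
  have hL (a : GroupLieAlgebra I G) := mdifferentiableAt_mulInvariantVectorField a (g := (1 : G))
  have hR (a : GroupLieAlgebra I G) := mdifferentiableAt_rightInvariantVectorField a (1 : G)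
  have key (a : GroupLieAlgebra I G) : cov (mulInvariantVectorField a) 1 u =
      cov (rightInvariantVectorField a) 1 u + ⁅u, a⁆ := by
    have h1 := CovariantDerivative.torsion_eq_zero_iff cov |>.1 hLC.torsion_eq_zero (hL u) (hL a)
    have h2 := CovariantDerivative.torsion_eq_zero_iff cov |>.1 hLC.torsion_eq_zero (hL u) (hR a)
    rw [mlieBracket_mulInvariantVectorField_rightInvariantVectorField,
      mulInvariantVectorField_one, rightInvariantVectorField_one, sub_eq_zero] at h2
    rw [mulInvariantVectorField_one, mulInvariantVectorField_one, ← h2, sub_eq_iff_eq_add] at h1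
    rw [h1, add_comm]
    rfl
  have h1 := covariantDerivative_skew hLC (fun y ↦ hinv.val_mulInvariantVectorField y v w)
    (hL v) (hL w) u
  have h2 := covariantDerivative_skew hLC (fun y ↦ hinv.val_rightInvariantVectorField y v w)
    (hR v) (hR w) u
  rw [key, key, map_add, map_add, mulInvariantVectorField_one, mulInvariantVectorField_one] at h1
  rw [rightInvariantVectorField_one, rightInvariantVectorField_one] at h2
  change g.val 1 _ w + g.val 1 _ w + _ = _ at h1
  linarith

/-- The Levi-Civita connection of a bi-invariant metric on left-invariant vector fields. -/
theorem covariantDerivative_mulInvariantVectorField [I.Boundaryless] (hinv : g.IsBiInvariant)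
    (hLC : g.IsLeviCivita cov) (x : G) (u v : GroupLieAlgebra I G) :
    cov (mulInvariantVectorField v) x (mulInvariantVectorField u x) =
      (1 / 2 : ℝ) • mulInvariantVectorField ⁅u, v⁆ x := by
  have hL (a : GroupLieAlgebra I G) := mdifferentiableAt_mulInvariantVectorField a (g := x)
  let B (u v w : GroupLieAlgebra I G) : ℝ :=
    g.val x (cov (mulInvariantVectorField v) x (mulInvariantVectorField u x))
      (mulInvariantVectorField w x)
  have hB (u v w : GroupLieAlgebra I G) : B u v w + B u w v = 0 := by
    simp only [B]
    rw [g.symm x (cov (mulInvariantVectorField w) x _)]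
    exact covariantDerivative_skew hLC (fun y ↦ hinv.val_mulInvariantVectorField y v w)
      (hL v) (hL w) _
  have hB' (u v w : GroupLieAlgebra I G) : B u v w - B v u w = g.val 1 ⁅u, v⁆ w := by
    have h1 := CovariantDerivative.torsion_eq_zero_iff cov |>.1 hLC.torsion_eq_zero (hL u) (hL v)
    rw [← mulInvariantVector_mlieBracket] at h1
    rw [← hinv.val_mulInvariantVectorField x]
    refine Eq.trans ?_ congr(g.val x $h1 (mulInvariantVectorField w x))
    rw [map_sub]
    rfl
  have hC (u v w : GroupLieAlgebra I G) : g.val 1 ⁅u, v⁆ w = - g.val 1 ⁅u, w⁆ v := by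
    have := hinv.val_lie_add hLC u v w
    rw [g.symm 1 v] at this
    linarith
  have hC' (u v w : GroupLieAlgebra I G) : g.val 1 ⁅u, v⁆ w = - g.val 1 ⁅v, u⁆ w := by
    rw [← lie_skew, map_neg]
    rfl
  rw [← sub_eq_zero]
  refine g.nondegenerate x _ fun t ↦ ?_
  obtain ⟨w, rfl⟩ := hinv.exists_mulInvariantVectorField_eq x t
  have e : g.val x ((1 / 2 : ℝ) • mulInvariantVectorField ⁅u, v⁆ x) (mulInvariantVectorField w x) =
      (1 / 2) * g.val 1 ⁅u, v⁆ w := by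
    rw [map_smul, ← hinv.val_mulInvariantVectorField x]
    rfl
  rw [map_sub]
  refine Eq.trans (congrArg (B u v w - ·) e) ?_
  linarith [hB u v w, hB v u w, hB w u v, hB' u v w, hB' u w v, hB' v w u, hC u v w, hC v w u,
    hC' u v w, hC' u w v, hC' v w u, hC w u v, hC' v u w]

lemma mdifferentiableAt_covariantDerivative_mulInvariantVectorField [I.Boundaryless]
    (hinv : g.IsBiInvariant) (hLC : g.IsLeviCivita cov) (v : GroupLieAlgebra I G) {x : G}
    {X : Π x : G, TangentSpace I x} (hX : MDiffAt (T% X) x) :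
    MDiffAt (T% (fun y ↦ cov (mulInvariantVectorField v) y (X y))) x := by
  obtain ⟨n, e, f, hf, hXf⟩ := hinv.exists_eq_sum_smul_mulInvariantVectorField hX
  have h : (fun y ↦ cov (mulInvariantVectorField v) y (X y)) =
      fun y ↦ ∑ i, f i y • (1 / 2 : ℝ) • mulInvariantVectorField ⁅e i, v⁆ y := by
    ext1 y
    rw [hXf, map_sum]
    refine Finset.sum_congr rfl fun i _ ↦ ?_
    rw [map_smul, hinv.covariantDerivative_mulInvariantVectorField hLC]
  change MDiffAt (fun y ↦ TotalSpace.mk' E y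
    ((fun y ↦ cov (mulInvariantVectorField v) y (X y)) y)) x
  rw [h]
  exact .sum_section fun i _ ↦ (hf i).smul_section <|
    mdifferentiableAt_const.smul_section (mdifferentiableAt_mulInvariantVectorField _)

theorem curvatureField_mulInvariantVectorField [I.Boundaryless] (hinv : g.IsBiInvariant)
    (hLC : g.IsLeviCivita cov) (x : G) (u v w : GroupLieAlgebra I G) :
    cov.curvatureField (mulInvariantVectorField u) (mulInvariantVectorField v)
      (mulInvariantVectorField w) x =
        -(1 / 4 : ℝ) • mulInvariantVectorField ⁅⁅u, v⁆, w⁆ x := by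
  have h1 (v w : GroupLieAlgebra I G) :
      (fun y ↦ cov (mulInvariantVectorField w) y (mulInvariantVectorField v y)) =
        (1 / 2 : ℝ) • mulInvariantVectorField ⁅v, w⁆ :=
    funext fun y ↦ hinv.covariantDerivative_mulInvariantVectorField hLC y v w
  have h2 (u v : GroupLieAlgebra I G) :
      cov ((1 / 2 : ℝ) • mulInvariantVectorField v) x (mulInvariantVectorField u x) =
        (1 / 4 : ℝ) • mulInvariantVectorField ⁅u, v⁆ x := by
    rw [cov.isCovariantDerivativeOn.smul_const (1 / 2 : ℝ)
      (mdifferentiableAt_mulInvariantVectorField v), smul_apply,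
      hinv.covariantDerivative_mulInvariantVectorField hLC, smul_smul]
    norm_num
  rw [CovariantDerivative.curvatureField, h1, h1, h2, h2, ← mulInvariantVector_mlieBracket,
    hinv.covariantDerivative_mulInvariantVectorField hLC]
  have h3 : mulInvariantVectorField ⁅u, ⁅v, w⁆⁆ x =
      mulInvariantVectorField ⁅⁅u, v⁆, w⁆ x + mulInvariantVectorField ⁅v, ⁅u, w⁆⁆ x := by
    rw [leibniz_lie, mulInvariantVectorField_add]
    rfl
  rw [h3]
  change _ - (1 / 2 : ℝ) • mulInvariantVectorField ⁅⁅u, v⁆, w⁆ x = _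
  module

theorem ricci_mulInvariantVectorField [I.Boundaryless] (hinv : g.IsBiInvariant)
    (hLC : g.IsLeviCivita cov) (v w : GroupLieAlgebra I G) :
    cov.ricci (mulInvariantVectorField v) (mulInvariantVectorField w) 1 =
      -(1 / 4) * killingForm ℝ (GroupLieAlgebra I G) v w := by
  let b : Module.Basis (Fin (Module.finrank ℝ E)) ℝ (GroupLieAlgebra I G) := Module.finBasis ℝ E
  have hR (i) : cov.curvatureField (FiberBundle.extend E (b i)) (mulInvariantVectorField v)
      (mulInvariantVectorField w) 1 = -(1 / 4 : ℝ) • ⁅w, ⁅v, b i⁆⁆ := by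
    have ht := cov.tensorialAt_curvatureField (Y := mulInvariantVectorField v) (x := (1 : G))
      fun X hX ↦ hinv.mdifferentiableAt_covariantDerivative_mulInvariantVectorField hLC w hX
    have hp := ht.pointwise (FiberBundle.mdifferentiableAt_extend I E _)
      (mdifferentiableAt_mulInvariantVectorField (b i))
      ((FiberBundle.extend_apply_self E _).trans (mulInvariantVectorField_one (b i)).symm)
    refine hp.trans ?_
    rw [hinv.curvatureField_mulInvariantVectorField hLC, mulInvariantVectorField_one,
      ← lie_skew w, ← lie_skew v (b i), neg_lie, neg_neg]
  have htr : killingForm ℝ (GroupLieAlgebra I G) v w = ∑ i, b.repr ⁅w, ⁅v, b i⁆⁆ i := by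
    rw [LieModule.traceForm_comm, killingForm_apply_apply,
      LinearMap.trace_eq_matrix_trace ℝ b]
    simp [Matrix.trace, LinearMap.toMatrix_apply]
  rw [htr, Finset.mul_sum]
  refine Finset.sum_congr rfl fun i _ ↦ ?_
  refine (congrArg (fun t ↦ b.repr t i) (hR i)).trans ?_
  rw [map_smul]
  rfl

end IsBiInvariant

end PseudoRiemannianMetric

end BiInvariant

theorem mainTheorem4 {E : Type*} [NormedAddCommGroup E] [NormedSpace ℝ E] [FiniteDimensional ℝ E]
    [CompleteSpace E] {H : Type*} [TopologicalSpace H] (I : ModelWithCorners ℝ E H) [I.Boundaryless]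
    {G : Type*} [TopologicalSpace G] [ChartedSpace H G] [Group G] [LieGroup I ∞ G]
    (g : PseudoRiemannianMetric I G) (hinv : g.IsBiInvariant) (hE : g.IsEinstein) :
    (IsSemisimpleLieGroup I G ∧
      ∃ c : ℝ, c ≠ 0 ∧ ∀ (x : G) (v w : GroupLieAlgebra I G),
        g.val x (mulInvariantVectorField v x) (mulInvariantVectorField w x) =
          c * killingForm ℝ (GroupLieAlgebra I G) v w) ∨
    (IsSolvableLieGroup I G ∧ killingForm ℝ (GroupLieAlgebra I G) = 0) := by
  obtain ⟨cov, hLC, c, hc⟩ := hE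
  have key (v w : GroupLieAlgebra I G) :
      -(1 / 4) * killingForm ℝ (GroupLieAlgebra I G) v w = c * g.val 1 v w := by
    rw [← hinv.ricci_mulInvariantVectorField hLC, hc _ _
      (contMDiff_infty_mulInvariantVectorField v) (contMDiff_infty_mulInvariantVectorField w),
      hinv.val_mulInvariantVectorField]
  by_cases h0 : c = 0
  · right
    have hκ : killingForm ℝ (GroupLieAlgebra I G) = 0 := by
      ext v w
      have := key v w
      rw [h0] at this
      simp only [LinearMap.zero_apply]
      linarith
    refine ⟨LieAlgebra.isSolvable_of_killingForm_apply_lie_eq_zero (R := ℝ) fun x y _ ↦ ?_, hκ⟩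
    rw [hκ]
    rfl
  · left
    have hg (v w : GroupLieAlgebra I G) :
        g.val 1 v w = -(1 / (4 * c)) * killingForm ℝ (GroupLieAlgebra I G) v w := by
      have := key v w
      field_simp
      linarith
    refine ⟨?_, -(1 / (4 * c)), by simpa using h0, fun x v w ↦ ?_⟩
    · have : LieAlgebra.IsKilling ℝ (GroupLieAlgebra I G) := by
        refine ⟨(LieSubmodule.eq_bot_iff _).2 fun v hv ↦ g.nondegenerate 1 v fun w ↦ ?_⟩
        rw [hg, LieModule.traceForm_comm, (LieIdeal.mem_killingCompl ℝ _ _).1 hv w trivial,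
          mul_zero]
      exact inferInstanceAs (LieAlgebra.IsSemisimple ℝ (GroupLieAlgebra I G))
    · rw [hinv.val_mulInvariantVectorField, hg]
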